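/- **Weak Closure Theorem for rank-one flows.** Let $X$ be a Polish space with its Borel $\sigma$-algebra, and let $\mu$ be a Borel probability measure on $X$ without atoms. Let $(T_t)_{t\in\mathbb R}$ be a flow on $(X,\mu)$: a jointly measurable action of $\mathbb R$ on $X$ by $\mu$-preserving bijections. Suppose that the flow is of rank one: there are measurable sets $E_j\subset X$, reals $s_j>0$ and integers $h_j\ge 1$ $(j\in\mathbb N)$ such that - for each $j$, the levels $T_{s_j}^iE_j$, $0\le i<h_j$, are pairwise disjoint (up to null sets); - the partitions $\xi_j=\{E_j,T_{s_j}E_j,\dots,T_{s_j}^{h_j-1}E_j,\ X\setminus\bigsqcup_{i<h_j}T_{s_j}^iE_j\}$ converge to the partition into points: for every measurable $A$ there are unions $A_j$ of cells of $\xi_j$ with $\mu(A\bigtriangleup A_j)\to0$; - $s_j/s_{j+1}$ is an integer for all $j$, $s_j\to0$ and $s_jh_j\to\infty$. Let $S$ be an automorphism of $(X,\mu)$ (a bimeasurable $\mu$-preserving bijection) such that, for every $t\in\mathbb R$, $ST_t=T_tS$ $\mu$-almost everywhere. For an automorphism $R$ of $(X,\mu)$ let $\Delta_R$ denote the image of $\mu$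 under $x\mapsto(x,R^{-1}x)$, that is, the probability measure on $X\times X$ with $\Delta_R(A\times B)=\mu(A\cap RB)$ for all measurable $A,B$, and put $\Delta^t=\Delta_{T_t}$. Then, for every choice of $(E_j),(s_j),(h_j)$ as above, there is a sequence of integers $(k_j)$ such that $\Delta^{k_js_j}\to\Delta_S$ weakly as $j\to\infty$ and, moreover, for all measurable sets $A,B\subset X$, $$\mu(A\cap T_{s_j}^{k_j}B)\longrightarrow\mu(A\cap SB)\qquad(j\to\infty).$$ -/

import Mathlib

open MeasureTheory Filter Topology
open scoped Pointwise

/-- The `i`-th level `T_{s j}^i E_j = T_{i * s j} E_j` of the `j`-th tower, where `T_t x = t +ᵥ x`. -/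
def towerLevel {X : Type*} [AddAction ℝ X] (E : ℕ → Set X) (s : ℕ → ℝ) (j i : ℕ) : Set X :=
  ((i : ℝ) * s j) +ᵥ E j

/-- The cells of the partition `ξ_j`: the levels `0, …, h j - 1` of the `j`-th tower, and the
complement of their union. -/
def towerCells {X : Type*} [AddAction ℝ X] (E : ℕ → Set X) (s : ℕ → ℝ) (h : ℕ → ℕ) (j : ℕ) :
    Set (Set X) :=
  {C | ∃ i < h j, C = towerLevel E s j i} ∪ {(⋃ i < h j, towerLevel E s j i)ᶜ}

/-- The flow `T_t x = t +ᵥ x` on `(X, μ)` is of rank one, as witnessed by the tower bases `E j`, the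
time steps `s j` and the heights `h j`. -/
structure IsRankOneFlowWith {X : Type*} [MeasurableSpace X] [AddAction ℝ X] (μ : Measure X)
    (E : ℕ → Set X) (s : ℕ → ℝ) (h : ℕ → ℕ) : Prop where
  measurableSet_base : ∀ j, MeasurableSet (E j)
  step_pos : ∀ j, 0 < s j
  height_pos : ∀ j, 0 < h j
  /-- The levels of each tower are disjoint, up to null sets. -/
  disjoint_levels : ∀ j, ∀ i < h j, ∀ i' < h j, i ≠ i' →
    AEDisjoint μ (towerLevel E s j i) (towerLevel E s j i')
  /-- The partitions converge to the partition into points: every measurable set is approximated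
  by unions of cells. -/
  tendsto_points : ∀ A, MeasurableSet A → ∃ A' : ℕ → Set X,
    (∀ j, ∃ P ⊆ towerCells E s h j, A' j = ⋃₀ P) ∧
      Tendsto (fun j => μ (symmDiff A (A' j))) atTop (𝓝 0)
  step_div : ∀ j, ∃ n : ℕ, s j / s (j + 1) = n
  tendsto_step : Tendsto s atTop (𝓝 0)
  tendsto_length : Tendsto (fun j => s j * h j) atTop atTop

/-- The probability measure `Δ_S` on `X × X`, the image of `μ` under `x ↦ (x, S⁻¹ x)`; see
`graphJoining_prod`. -/
noncomputable def graphJoining {X : Type*} [MeasurableSpace X] (μ : Measure X)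
    [IsProbabilityMeasure μ] (S : X ≃ᵐ X) : ProbabilityMeasure (X × X) :=
  ⟨μ.map (fun x => (x, S.symm x)),
    Measure.isProbabilityMeasure_map (measurable_id.prodMk S.symm.measurable).aemeasurable⟩

theorem graphJoining_prod {X : Type*} [MeasurableSpace X] (μ : Measure X)
    [IsProbabilityMeasure μ] (S : X ≃ᵐ X) {A B : Set X} (hA : MeasurableSet A)
    (hB : MeasurableSet B) :
    (graphJoining μ S : Measure (X × X)) (A ×ˢ B) = μ (A ∩ S '' B) := by
  change (μ.map (fun x => (x, S.symm x))) (A ×ˢ B) = _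
  have hm : Measurable (fun x => (x, S.symm x)) := measurable_id.prodMk S.symm.measurable
  rw [Measure.map_apply hm (hA.prod hB), S.image_eq_preimage_symm]
  rfl

/-!
Write `T_t` for the flow and fix one tower with base `E`, step `s` and height `h`; its levels are
`F_a = T_s^a E`, `0 ≤ a < h`. Since `S` commutes with the flow, the mass `μ(F_a ∩ S F_b)` which the
graph joining of `S` gives to a pair of levels depends only on the displacement `a - b`
(`measureReal_flowLevel_inter_image`).

Let `B` and `S B` be close to the unions of the levels with indices in `J` and `I`, and call the
pair `(a, b)` mismatched if exactly one of `a ∈ I`, `b ∈ J` holds. Mismatched pairs carry little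
mass, because the graph joining of `S` lives on a graph (`sum_mismatch_le`). By Markov's inequality,
nearly all of its mass is on columns `a - b = k` with a small proportion of mismatched pairs. For
such a displacement `k`, the set `T_s^k B` is close to `S B` on the overlap
`Y = ⋃ {F_a | 0 ≤ a < h, 0 ≤ a - k < h}` of the tower with its translate
(`measureReal_overlap_inter_symmDiff_le`).

To pass from the overlap to the whole space, take such a `k` with `|k|` minimal
(`exists_displacement`). If a point `x` of the tower lies outside `Y`, then `x` and `S x` typically
lie in levels whose displacement is at least `|k|` in absolute value, and as both indices are
between `0` and `h`, the point `S x` must lie in `Y`. Thus `Y` and `S⁻¹ Y` nearly cover `X`, and on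
`S⁻¹ Y` the difference between `S B` and `T_s^k B` is, by commutation, the difference between
`S² B` and `T_s^k S B` on `Y` (`exists_symmDiff_image_vadd_le`).

Since `μ` has no atoms, the towers fill the space
(`IsRankOneFlowWith.tendsto_measureReal_compl`), and the approximation above works for every finite
family of sets on all late towers. A diagonal choice over the countable dense family of unions of
levels gives `μ(S B ∆ T_{s_j}^{k_j} B) → 0` for every measurable `B`, which implies both assertions.
-/

/-! ### Automorphisms commuting with the flow -/

section Commute

variable {X : Type*} [MeasurableSpace X] {μ : Measure X} {S : X ≃ᵐ X}

theorem MeasureTheory.MeasurePreserving.measure_image_equiv (hS : MeasurePreserving S μ μ)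
    (A : Set X) : μ (S '' A) = μ A := by
  rw [S.image_eq_preimage_symm]
  exact (hS.symm S).measure_preimage_equiv A

theorem MeasureTheory.MeasurePreserving.measureReal_image_equiv (hS : MeasurePreserving S μ μ)
    (A : Set X) : μ.real (S '' A) = μ.real A := by
  rw [measureReal_def, hS.measure_image_equiv, measureReal_def]

theorem measureReal_vadd [AddAction ℝ X] [VAddInvariantMeasure ℝ X μ] (t : ℝ) (A : Set X) :
    μ.real (t +ᵥ A) = μ.real A := by
  rw [measureReal_def, measure_vadd, measureReal_def]

theorem image_vadd_ae_eq [AddAction ℝ X] [MeasurableVAdd₂ ℝ X] [VAddInvariantMeasure ℝ X μ]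
    (hS : MeasurePreserving S μ μ)
    (hcomm : ∀ t : ℝ, ∀ᵐ x ∂μ, S (t +ᵥ x) = t +ᵥ S x) (t : ℝ) (A : Set X) :
    (S '' (t +ᵥ A) : Set X) =ᵐ[μ] (t +ᵥ S '' A : Set X) := by
  have h : ∀ᵐ x ∂μ, S (-t +ᵥ S.symm x) = -t +ᵥ S (S.symm x) :=
    (hS.symm S).quasiMeasurePreserving.ae (hcomm (-t))
  filter_upwards [h] with x hx
  rw [S.apply_symm_apply] at hx
  apply propext
  change x ∈ S '' (t +ᵥ A) ↔ x ∈ t +ᵥ S '' A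
  rw [S.image_eq_preimage_symm, S.image_eq_preimage_symm, Set.mem_preimage,
    Set.mem_vadd_set_iff_neg_vadd_mem, Set.mem_vadd_set_iff_neg_vadd_mem, Set.mem_preimage,
    ← hx, S.symm_apply_apply]

end Commute

/-! ### Counting mismatches in a tower -/

/-- The level `T_s^a E` of the tower over `E`, for an arbitrary integer `a`. -/
def flowLevel {X : Type*} [AddAction ℝ X] (E : Set X) (s : ℝ) (a : ℤ) : Set X :=
  ((a : ℝ) * s) +ᵥ E

/-- The union of the levels with index in `I`. -/
def levelUnion {X : Type*} [AddAction ℝ X] (E : Set X) (s : ℝ) (I : Finset ℤ) : Set X :=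
  ⋃ a ∈ I, flowLevel E s a

theorem mem_levelUnion {X : Type*} [AddAction ℝ X] {E : Set X} {s : ℝ} {I : Finset ℤ} {x : X} :
    x ∈ levelUnion E s I ↔ ∃ a ∈ I, x ∈ flowLevel E s a := by
  simp [levelUnion]

theorem vadd_flowLevel {X : Type*} [AddAction ℝ X] (E : Set X) (s : ℝ) (k a : ℤ) :
    ((k : ℝ) * s) +ᵥ flowLevel E s a = flowLevel E s (k + a) := by
  rw [flowLevel, flowLevel, vadd_vadd]
  push_cast
  ring_nf

/-- The pairs of levels at displacement `k` in a tower of height `h` which lie in exactly one of the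
two unions of levels given by `I` (first coordinate) and `J` (second coordinate). -/
noncomputable def mismatch (h : ℤ) (I J : Finset ℤ) (k : ℤ) : Finset (ℤ × ℤ) :=
  {p ∈ Finset.Ico 0 h ×ˢ Finset.Ico 0 h | p.1 - p.2 = k ∧ ¬(p.1 ∈ I ↔ p.2 ∈ J)}

theorem mem_mismatch {h : ℤ} {I J : Finset ℤ} {k : ℤ} {p : ℤ × ℤ} :
    p ∈ mismatch h I J k ↔ (p.1 ∈ Finset.Ico 0 h ∧ p.2 ∈ Finset.Ico 0 h) ∧
      p.1 - p.2 = k ∧ ¬(p.1 ∈ I ↔ p.2 ∈ J) := by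
  simp [mismatch]

/-- The indices of those levels of a tower of height `h` whose translate by `-k` is again a level
of the tower. -/
noncomputable def overlap (h k : ℤ) : Finset ℤ :=
  {a ∈ Finset.Ico 0 h | a - k ∈ Finset.Ico 0 h}

theorem mem_overlap {h k a : ℤ} :
    a ∈ overlap h k ↔ a ∈ Finset.Ico 0 h ∧ a - k ∈ Finset.Ico 0 h := by
  simp [overlap]

theorem measureReal_flowLevel {X : Type*} [MeasurableSpace X] {μ : Measure X} [AddAction ℝ X]
    [VAddInvariantMeasure ℝ X μ] {E : Set X} {s : ℝ} (a : ℤ) :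
    μ.real (flowLevel E s a) = μ.real E :=
  measureReal_vadd _ _

/-- Almost every point lies in at most one level of the tower. -/
theorem ae_unique_level {X : Type*} [MeasurableSpace X] {μ : Measure X} [AddAction ℝ X]
    {E : Set X} {s : ℝ} {h : ℤ}
    (hdisj : Set.Pairwise (Finset.Ico 0 h : Set ℤ)
      (fun a b => AEDisjoint μ (flowLevel E s a) (flowLevel E s b))) :
    ∀ᵐ x ∂μ, ∀ a ∈ Finset.Ico 0 h, ∀ b ∈ Finset.Ico 0 h,
      x ∈ flowLevel E s a → x ∈ flowLevel E s b → a = b := by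
  refine (ae_ball_iff (Finset.countable_toSet _)).2 fun a ha => ?_
  refine (ae_ball_iff (Finset.countable_toSet _)).2 fun b hb => ?_
  by_cases hab : a = b
  · exact Eventually.of_forall fun x _ _ => hab
  · have h0 : μ (flowLevel E s a ∩ flowLevel E s b) = 0 :=
      hdisj (by exact_mod_cast ha) (by exact_mod_cast hb) hab
    filter_upwards [measure_eq_zero_iff_ae_notMem.1 h0] with x hx h1 h2
    exact absurd ⟨h1, h2⟩ hx

theorem pairwise_aedisjoint_levelProd {X : Type*} [MeasurableSpace X] {μ : Measure X}
    [AddAction ℝ X] {E : Set X} {s : ℝ} {h : ℤ} {S : X ≃ᵐ X} (hS : MeasurePreserving S μ μ)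
    (hdisj : Set.Pairwise (Finset.Ico 0 h : Set ℤ)
      (fun a b => AEDisjoint μ (flowLevel E s a) (flowLevel E s b))) :
    Set.Pairwise ((Finset.Ico 0 h ×ˢ Finset.Ico 0 h : Finset (ℤ × ℤ)) : Set (ℤ × ℤ))
      (Function.onFun (AEDisjoint μ) fun p => flowLevel E s p.1 ∩ S '' flowLevel E s p.2) := by
  have hU := ae_unique_level hdisj
  have hU' := (hS.symm S).quasiMeasurePreserving.ae hU
  intro p hp q hq hpq
  simp only [Finset.coe_product, Set.mem_prod, Finset.mem_coe] at hp hq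
  refine measure_eq_zero_iff_ae_notMem.2 ?_
  filter_upwards [hU, hU'] with x hx hx' hmem
  rw [S.image_eq_preimage_symm, S.image_eq_preimage_symm] at hmem
  exact hpq (Prod.ext (hx _ hp.1 _ hq.1 hmem.1.1 hmem.2.1)
    (hx' _ hp.2 _ hq.2 hmem.1.2 hmem.2.2))

section Tower

variable {X : Type*} [MeasurableSpace X] {μ : Measure X}
  [AddAction ℝ X] [MeasurableVAdd₂ ℝ X] [VAddInvariantMeasure ℝ X μ]
  {E : Set X} {s : ℝ} {h : ℤ} {S : X ≃ᵐ X}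

theorem measurableSet_flowLevel (hE : MeasurableSet E) (a : ℤ) :
    MeasurableSet (flowLevel E s a) :=
  hE.const_vadd _

/-- The graph joining of `S` gives a product of two levels a mass which depends only on the
displacement between them. -/
theorem measureReal_flowLevel_inter_image (hS : MeasurePreserving S μ μ)
    (hcomm : ∀ t : ℝ, ∀ᵐ x ∂μ, S (t +ᵥ x) = t +ᵥ S x) (a b : ℤ) :
    μ.real (flowLevel E s a ∩ S '' flowLevel E s b) =
      μ.real (flowLevel E s (a - b) ∩ S '' E) := by
  have h1 : (S '' flowLevel E s b : Set X) =ᵐ[μ] (((b : ℝ) * s) +ᵥ S '' E : Set X) :=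
    image_vadd_ae_eq hS hcomm _ _
  have h2 : flowLevel E s a = ((b : ℝ) * s) +ᵥ flowLevel E s (a - b) := by
    rw [vadd_flowLevel]; congr 1; ring
  rw [measureReal_congr ((ae_eq_refl _).inter h1), h2, ← Set.vadd_set_inter, measureReal_vadd]

variable [IsProbabilityMeasure μ]

/-- The mismatched pairs of levels carry little mass of the graph joining of `S` if the union of the
levels in `I` is close to the image under `S` of the union of the levels in `J`. -/
theorem sum_mismatch_le (hE : MeasurableSet E) (hS : MeasurePreserving S μ μ)
    (hcomm : ∀ t : ℝ, ∀ᵐ x ∂μ, S (t +ᵥ x) = t +ᵥ S x)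
    (hdisj : Set.Pairwise (Finset.Ico 0 h : Set ℤ)
      (fun a b => AEDisjoint μ (flowLevel E s a) (flowLevel E s b)))
    {I J : Finset ℤ} (hI : I ⊆ Finset.Ico 0 h) (hJ : J ⊆ Finset.Ico 0 h) (K : Finset ℤ) :
    ∑ k ∈ K, (mismatch h I J k).card * μ.real (flowLevel E s k ∩ S '' E) ≤
      μ.real (symmDiff (levelUnion E s I) (S '' levelUnion E s J)) := by
  classical
  have hU := ae_unique_level hdisj
  have hU' := (hS.symm S).quasiMeasurePreserving.ae hU
  set M : Finset (ℤ × ℤ) := K.biUnion (mismatch h I J) with hM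
  have hMsub : M ⊆ Finset.Ico 0 h ×ˢ Finset.Ico 0 h := by
    intro p hp
    obtain ⟨k, -, hk⟩ := Finset.mem_biUnion.1 hp
    exact Finset.mem_product.2 (mem_mismatch.1 hk).1
  have hsum : ∑ k ∈ K, (mismatch h I J k).card * μ.real (flowLevel E s k ∩ S '' E) =
      ∑ p ∈ M, μ.real (flowLevel E s p.1 ∩ S '' flowLevel E s p.2) := by
    rw [hM, Finset.sum_biUnion]
    · refine Finset.sum_congr rfl fun k _ => ?_
      rw [← nsmul_eq_mul, ← Finset.sum_const]
      refine Finset.sum_congr rfl fun p hp => ?_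
      rw [measureReal_flowLevel_inter_image hS hcomm, (mem_mismatch.1 hp).2.1]
    · intro k _ k' _ hkk
      refine Finset.disjoint_left.2 fun p hp hp' => hkk ?_
      rw [← (mem_mismatch.1 hp).2.1, (mem_mismatch.1 hp').2.1]
  rw [hsum, ← measureReal_biUnion_finset₀
    ((pairwise_aedisjoint_levelProd hS hdisj).mono (by exact_mod_cast hMsub))
    fun p _ => ((measurableSet_flowLevel hE _).inter
      (S.measurableSet_image.2 (measurableSet_flowLevel hE _))).nullMeasurableSet]
  refine ENNReal.toReal_mono (measure_ne_top _ _) (measure_mono_ae ?_)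
  filter_upwards [hU, hU'] with x hx hx' hmem
  change x ∈ symmDiff (levelUnion E s I) (S '' levelUnion E s J)
  replace hmem : x ∈ ⋃ p ∈ M, flowLevel E s p.1 ∩ S '' flowLevel E s p.2 := hmem
  simp only [Set.mem_iUnion] at hmem
  obtain ⟨p, hp, hxp, hxp'⟩ := hmem
  obtain ⟨k, -, hk⟩ := Finset.mem_biUnion.1 hp
  obtain ⟨⟨hp1, hp2⟩, -, hmis⟩ := mem_mismatch.1 hk
  rw [S.image_eq_preimage_symm] at hxp' ⊢
  have h1 : x ∈ levelUnion E s I ↔ p.1 ∈ I := by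
    rw [mem_levelUnion]
    exact ⟨fun ⟨a, ha, hxa⟩ => hx _ (hI ha) _ hp1 hxa hxp ▸ ha, fun hi => ⟨_, hi, hxp⟩⟩
  have h2 : S.symm x ∈ levelUnion E s J ↔ p.2 ∈ J := by
    rw [mem_levelUnion]
    exact ⟨fun ⟨a, ha, hxa⟩ => hx' _ (hJ ha) _ hp2 hxa hxp' ▸ ha, fun hi => ⟨_, hi, hxp'⟩⟩
  rw [Set.mem_symmDiff, Set.mem_preimage, h1, h2]
  tauto

/-- On the overlap of the tower with its translate by `k`, the mismatches at displacement `k`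
control the difference between one union of levels and the translate of another. -/
theorem measureReal_overlap_inter_symmDiff_le
    (hdisj : Set.Pairwise (Finset.Ico 0 h : Set ℤ)
      (fun a b => AEDisjoint μ (flowLevel E s a) (flowLevel E s b)))
    {I J : Finset ℤ} (hI : I ⊆ Finset.Ico 0 h) (hJ : J ⊆ Finset.Ico 0 h) (k : ℤ) :
    μ.real (levelUnion E s (overlap h k) ∩
        symmDiff (levelUnion E s I) (((k : ℝ) * s) +ᵥ levelUnion E s J)) ≤
      (mismatch h I J k).card * μ.real E := by
  have hU := ae_unique_level hdisj
  have hU' := (measurePreserving_vadd (-((k : ℝ) * s)) μ).quasiMeasurePreserving.ae hU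
  have key : μ.real (⋃ p ∈ mismatch h I J k, flowLevel E s p.1) ≤
      (mismatch h I J k).card * μ.real E := by
    refine (measureReal_biUnion_finset_le _ _).trans_eq ?_
    simp only [measureReal_flowLevel, Finset.sum_const, nsmul_eq_mul]
  refine le_trans (ENNReal.toReal_mono (measure_ne_top _ _) (measure_mono_ae ?_)) key
  filter_upwards [hU, hU'] with x hx hx' hmem
  obtain ⟨hY, hD⟩ := hmem
  obtain ⟨a, ha, hxa⟩ := mem_levelUnion.1 hY
  obtain ⟨ha1, ha2⟩ := mem_overlap.1 ha
  have hxa' : -((k : ℝ) * s) +ᵥ x ∈ flowLevel E s (a - k) := by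
    rw [← Set.mem_vadd_set_iff_neg_vadd_mem, vadd_flowLevel]
    simpa using hxa
  have h1 : x ∈ levelUnion E s I ↔ a ∈ I := by
    rw [mem_levelUnion]
    exact ⟨fun ⟨b, hb, hxb⟩ => hx _ (hI hb) _ ha1 hxb hxa ▸ hb, fun hi => ⟨_, hi, hxa⟩⟩
  have h2 : x ∈ ((k : ℝ) * s) +ᵥ levelUnion E s J ↔ a - k ∈ J := by
    rw [Set.mem_vadd_set_iff_neg_vadd_mem, mem_levelUnion]
    exact ⟨fun ⟨b, hb, hxb⟩ => hx' _ (hJ hb) _ ha2 hxb hxa' ▸ hb, fun hi => ⟨_, hi, hxa'⟩⟩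
  have hD' : x ∈ symmDiff (levelUnion E s I) (((k : ℝ) * s) +ᵥ levelUnion E s J) := hD
  rw [Set.mem_symmDiff, h1, h2] at hD'
  refine Set.mem_iUnion₂.2 ⟨(a, a - k), mem_mismatch.2 ⟨⟨ha1, ha2⟩, by simp, ?_⟩, hxa⟩
  tauto

end Tower

/-! ### A good displacement of least absolute value -/

/-- The column at displacement `k` has `h` members of equal mass; the levels `b + k` are allowed to
lie outside the tower. -/
theorem measureReal_column_le {X : Type*} [MeasurableSpace X] {μ : Measure X} [AddAction ℝ X]
    [MeasurableVAdd₂ ℝ X] [VAddInvariantMeasure ℝ X μ] {E : Set X} {s : ℝ} {h : ℤ} {S : X ≃ᵐ X}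
    (hS : MeasurePreserving S μ μ)
    (hcomm : ∀ t : ℝ, ∀ᵐ x ∂μ, S (t +ᵥ x) = t +ᵥ S x) (h0 : 0 ≤ h) (k : ℤ) :
    μ.real (⋃ b ∈ Finset.Ico 0 h, flowLevel E s (b + k) ∩ S '' flowLevel E s b) ≤
      h * μ.real (flowLevel E s k ∩ S '' E) := by
  refine (measureReal_biUnion_finset_le _ _).trans_eq ?_
  simp only [measureReal_flowLevel_inter_image hS hcomm, add_sub_cancel_left, Finset.sum_const,
    Int.card_Ico, nsmul_eq_mul, sub_zero]
  congr 1
  exact_mod_cast Int.toNat_of_nonneg h0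

section GoodDisplacement

variable {X : Type*} [MeasurableSpace X] {μ : Measure X} [IsProbabilityMeasure μ]
  [AddAction ℝ X] [MeasurableVAdd₂ ℝ X] [VAddInvariantMeasure ℝ X μ]
  {E : Set X} {s : ℝ} {h : ℤ} {S : X ≃ᵐ X}

theorem height_mul_measureReal_base_le_one (hE : MeasurableSet E) (h0 : 0 ≤ h)
    (hdisj : Set.Pairwise (Finset.Ico 0 h : Set ℤ)
      (fun a b => AEDisjoint μ (flowLevel E s a) (flowLevel E s b))) :
    (h : ℝ) * μ.real E ≤ 1 := by
  have h1 : μ.real (⋃ a ∈ Finset.Ico 0 h, flowLevel E s a) = h * μ.real E := by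
    rw [measureReal_biUnion_finset₀ hdisj
      fun a _ => (measurableSet_flowLevel hE a).nullMeasurableSet]
    simp only [measureReal_flowLevel, Finset.sum_const, Int.card_Ico, nsmul_eq_mul, sub_zero]
    congr 1
    exact_mod_cast Int.toNat_of_nonneg h0
  rw [← h1]
  exact measureReal_le_one

/-- Among the displacements with few mismatches, one of least absolute value is such that all
points of the tower outside a set of small measure lie in the overlap of the tower with its
translate, or are sent there by `S`. -/
theorem exists_displacement (hE : MeasurableSet E) (hS : MeasurePreserving S μ μ)
    (hcomm : ∀ t : ℝ, ∀ᵐ x ∂μ, S (t +ᵥ x) = t +ᵥ S x) (h0 : 0 ≤ h)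
    (hdisj : Set.Pairwise (Finset.Ico 0 h : Set ℤ)
      (fun a b => AEDisjoint μ (flowLevel E s a) (flowLevel E s b)))
    {η ε : ℝ} (hε : 0 < ε) (hcover : μ.real (levelUnion E s (Finset.Ico 0 h))ᶜ ≤ η)
    (σ : Finset (Set X)) (I : Set X → Finset ℤ) (hI : ∀ A, I A ⊆ Finset.Ico 0 h)
    (hIσ : ∀ B ∈ σ, μ.real (symmDiff B (levelUnion E s (I B))) ≤ η)
    (hIS : ∀ B ∈ σ, μ.real (symmDiff (S '' B) (levelUnion E s (I (S '' B)))) ≤ η) :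
    ∃ k : ℤ,
      (∀ B ∈ σ, μ.real (levelUnion E s (overlap h k) ∩
        symmDiff (S '' B) (((k : ℝ) * s) +ᵥ B)) ≤ ε + 2 * η) ∧
      μ.real (levelUnion E s (Finset.Ico 0 h) \
        (levelUnion E s (overlap h k) ∪ S ⁻¹' levelUnion E s (overlap h k))) ≤
          η + 2 * σ.card * η / ε := by
  classical
  set U := levelUnion E s with hUdef
  set c : ℤ → ℝ := fun k => μ.real (flowLevel E s k ∩ S '' E) with hc
  set m : ℤ → ℝ := fun k => ∑ B ∈ σ, ((mismatch h (I (S '' B)) (I B) k).card : ℝ) with hm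
  set good : Set ℤ := {k | m k * μ.real E ≤ ε} with hgood
  -- The displacement `h` is vacuously good, since its column is empty.
  have hne : good.Nonempty := by
    refine ⟨h, ?_⟩
    have hm0 : m h = 0 := by
      refine Finset.sum_eq_zero fun B _ => ?_
      rw [Nat.cast_eq_zero, Finset.card_eq_zero, Finset.eq_empty_iff_forall_notMem]
      intro p hp
      obtain ⟨⟨h1, h2⟩, h3, -⟩ := mem_mismatch.1 hp
      rw [Finset.mem_Ico] at h1 h2
      omega
    change m h * μ.real E ≤ ε
    rw [hm0, zero_mul]
    exact hε.le
  obtain ⟨k, hk, hmin⟩ := (measure Int.natAbs).wf.has_min good hne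
  refine ⟨k, fun B hB => ?_, ?_⟩
  · have hsub : U (overlap h k) ∩ symmDiff (S '' B) (((k : ℝ) * s) +ᵥ B) ⊆
        symmDiff (S '' B) (U (I (S '' B))) ∪
          (U (overlap h k) ∩ symmDiff (U (I (S '' B))) (((k : ℝ) * s) +ᵥ U (I B))) ∪
          (((k : ℝ) * s) +ᵥ symmDiff B (U (I B))) := by
      rw [Set.vadd_set_symmDiff]
      rintro x ⟨hx1, hx2⟩
      simp only [Set.mem_union, Set.mem_inter_iff, Set.mem_symmDiff] at hx2 ⊢
      tauto
    have h1 := measureReal_overlap_inter_symmDiff_le hdisj (hI (S '' B)) (hI B) k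
    have h2 : ((mismatch h (I (S '' B)) (I B) k).card : ℝ) ≤ m k :=
      Finset.single_le_sum (f := fun B => ((mismatch h (I (S '' B)) (I B) k).card : ℝ))
        (fun _ _ => Nat.cast_nonneg _) hB
    have h3 : m k * μ.real E ≤ ε := hk
    have h4 := mul_le_mul_of_nonneg_right h2 (measureReal_nonneg (μ := μ) (s := E))
    have h5 := measureReal_mono hsub (measure_ne_top μ _)
    have h6 := measureReal_union_le (μ := μ) (symmDiff (S '' B) (U (I (S '' B))) ∪
          (U (overlap h k) ∩ symmDiff (U (I (S '' B))) (((k : ℝ) * s) +ᵥ U (I B))))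
          (((k : ℝ) * s) +ᵥ symmDiff B (U (I B)))
    have h7 := measureReal_union_le (μ := μ) (symmDiff (S '' B) (U (I (S '' B))))
          (U (overlap h k) ∩ symmDiff (U (I (S '' B))) (((k : ℝ) * s) +ᵥ U (I B)))
    rw [measureReal_vadd] at h6
    have h8 := hIσ B hB
    have h9 := hIS B hB
    linarith
  · set K : Finset ℤ := {l ∈ Finset.Ioo (-h) h | l ∉ good} with hK
    set Z : ℤ → Set X := fun l =>
      ⋃ b ∈ Finset.Ico 0 h, flowLevel E s (b + l) ∩ S '' flowLevel E s b with hZ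
    have hsub : U (Finset.Ico 0 h) \ (U (overlap h k) ∪ S ⁻¹' U (overlap h k)) ⊆
        S ⁻¹' ((U (Finset.Ico 0 h))ᶜ ∪ ⋃ l ∈ K, Z l) := by
      rintro x ⟨hxU, hx⟩
      by_contra hcon
      simp only [Set.mem_preimage, Set.mem_union, not_or, Set.mem_compl_iff, not_not,
        Set.mem_iUnion, not_exists] at hx hcon
      obtain ⟨hSU, hbad⟩ := hcon
      obtain ⟨a, ha, hxa⟩ := mem_levelUnion.1 hxU
      obtain ⟨a', ha', hxa'⟩ := mem_levelUnion.1 hSU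
      have e1 : a - k ∉ Finset.Ico 0 h := fun hak =>
        hx.1 (mem_levelUnion.2 ⟨a, mem_overlap.2 ⟨ha, hak⟩, hxa⟩)
      have e2 : a' - k ∉ Finset.Ico 0 h := fun hak =>
        hx.2 (mem_levelUnion.2 ⟨a', mem_overlap.2 ⟨ha', hak⟩, hxa'⟩)
      have e3 : a' - a ∈ good := by
        by_contra hng
        refine hbad (a' - a) (Finset.mem_filter.2 ⟨?_, hng⟩) ?_
        · rw [Finset.mem_Ico] at ha ha'
          rw [Finset.mem_Ioo]
          omega
        · refine Set.mem_iUnion₂.2 ⟨a, ha, ?_, Set.mem_image_of_mem _ hxa⟩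
          rwa [add_sub_cancel]
      -- Minimality of `|k|` is what brings `S x` into the overlap.
      have e4 : ¬ (a' - a).natAbs < k.natAbs := hmin _ e3
      rw [Finset.mem_Ico] at ha ha' e1 e2
      omega
    have hZsum : μ.real (⋃ l ∈ K, Z l) ≤ ∑ l ∈ K, h * c l :=
      (measureReal_biUnion_finset_le _ _).trans
        (Finset.sum_le_sum fun l _ => measureReal_column_le hS hcomm h0 l)
    have hmc : ∑ l ∈ K, m l * c l ≤ 2 * σ.card * η := by
      simp only [hm, Finset.sum_mul]
      rw [Finset.sum_comm]
      calc ∑ B ∈ σ, ∑ l ∈ K, ((mismatch h (I (S '' B)) (I B) l).card : ℝ) * c l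
          ≤ ∑ B ∈ σ, 2 * η := by
            refine Finset.sum_le_sum fun B hB => ?_
            refine (sum_mismatch_le hE hS hcomm hdisj (hI _) (hI _) K).trans ?_
            refine (measureReal_symmDiff_le (t := S '' B) _).trans ?_
            rw [symmDiff_comm, ← Set.image_symmDiff S.injective, hS.measureReal_image_equiv]
            have h8 := hIσ B hB
            have h9 := hIS B hB
            linarith
        _ = 2 * σ.card * η := by rw [Finset.sum_const, nsmul_eq_mul]; ring
    have hbase := height_mul_measureReal_base_le_one hE h0 hdisj
    have hh : (0 : ℝ) ≤ h := by exact_mod_cast h0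
    -- Markov's inequality for the number of mismatches, averaged over the columns.
    have hmarkov : (∑ l ∈ K, h * c l) * ε ≤ 2 * σ.card * η := by
      calc (∑ l ∈ K, h * c l) * ε = ∑ l ∈ K, h * c l * ε := Finset.sum_mul _ _ _
        _ ≤ ∑ l ∈ K, (h * μ.real E) * (m l * c l) := by
            refine Finset.sum_le_sum fun l hl => ?_
            have h1 : ε ≤ m l * μ.real E := (not_le.1 (Finset.mem_filter.1 hl).2).le
            calc (h : ℝ) * c l * ε ≤ h * c l * (m l * μ.real E) :=
                  mul_le_mul_of_nonneg_left h1 (mul_nonneg hh measureReal_nonneg)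
              _ = (h * μ.real E) * (m l * c l) := by ring
        _ = (h * μ.real E) * ∑ l ∈ K, m l * c l := by rw [Finset.mul_sum]
        _ ≤ 1 * ∑ l ∈ K, m l * c l :=
            mul_le_mul_of_nonneg_right hbase (Finset.sum_nonneg fun l _ =>
              mul_nonneg (Finset.sum_nonneg fun _ _ => Nat.cast_nonneg _) measureReal_nonneg)
        _ ≤ 2 * σ.card * η := by rw [one_mul]; exact hmc
    have hdiv : ∑ l ∈ K, h * c l ≤ 2 * σ.card * η / ε := (le_div_iff₀ hε).2 hmarkov
    calc μ.real (U (Finset.Ico 0 h) \ (U (overlap h k) ∪ S ⁻¹' U (overlap h k)))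
        ≤ μ.real (S ⁻¹' ((U (Finset.Ico 0 h))ᶜ ∪ ⋃ l ∈ K, Z l)) := measureReal_mono hsub
      _ = μ.real ((U (Finset.Ico 0 h))ᶜ ∪ ⋃ l ∈ K, Z l) := by
          rw [measureReal_def, hS.measure_preimage_equiv, measureReal_def]
      _ ≤ μ.real (U (Finset.Ico 0 h))ᶜ + μ.real (⋃ l ∈ K, Z l) := measureReal_union_le _ _
      _ ≤ η + 2 * σ.card * η / ε := by linarith

/-- Approximation at a single tower: if `B`, `S B` and `S² B` are all close to unions of levels,
then one translation is close to `S` on `B`, simultaneously for all `B` in a finite family. -/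
theorem exists_symmDiff_image_vadd_le (hE : MeasurableSet E) (hS : MeasurePreserving S μ μ)
    (hcomm : ∀ t : ℝ, ∀ᵐ x ∂μ, S (t +ᵥ x) = t +ᵥ S x) (h0 : 0 ≤ h)
    (hdisj : Set.Pairwise (Finset.Ico 0 h : Set ℤ)
      (fun a b => AEDisjoint μ (flowLevel E s a) (flowLevel E s b)))
    {η ε : ℝ} (hε : 0 < ε) (hcover : μ.real (levelUnion E s (Finset.Ico 0 h))ᶜ ≤ η)
    (σ : Finset (Set X)) (I : Set X → Finset ℤ) (hI : ∀ A, I A ⊆ Finset.Ico 0 h)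
    (hIσ : ∀ B ∈ σ, μ.real (symmDiff B (levelUnion E s (I B))) ≤ η)
    (hIS : ∀ B ∈ σ, μ.real (symmDiff (S '' B) (levelUnion E s (I (S '' B)))) ≤ η) :
    ∃ k : ℤ, ∀ B ∈ σ, S '' B ∈ σ →
      μ.real (symmDiff (S '' B) (((k : ℝ) * s) +ᵥ B)) ≤
        2 * ε + 6 * η + 2 * σ.card * η / ε := by
  obtain ⟨k, hk, hbad⟩ := exists_displacement hE hS hcomm h0 hdisj hε hcover σ I hI hIσ hIS
  refine ⟨k, fun B hB hSB => ?_⟩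
  set Y := levelUnion E s (overlap h k)
  set V := levelUnion E s (Finset.Ico 0 h)
  set D := symmDiff (S '' B) (((k : ℝ) * s) +ᵥ B)
  have hsub : D ⊆ (Vᶜ ∪ (V \ (Y ∪ S ⁻¹' Y))) ∪ ((Y ∩ D) ∪ (S ⁻¹' Y ∩ D)) := by
    intro x hx
    simp only [Set.mem_union, Set.mem_compl_iff, Set.mem_sdiff, Set.mem_inter_iff]
    tauto
  -- Since `S` commutes with the translation, the error on the preimage of the overlap for `B` is
  -- the error on the overlap for `S B`.
  have hshift : μ.real (S ⁻¹' Y ∩ D) =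
      μ.real (Y ∩ symmDiff (S '' (S '' B)) (((k : ℝ) * s) +ᵥ S '' B)) := by
    rw [← hS.measureReal_image_equiv, Set.image_preimage_inter, Set.image_symmDiff S.injective]
    refine measureReal_congr ((ae_eq_refl _).inter ?_)
    exact (ae_eq_refl _).symmDiff (image_vadd_ae_eq hS hcomm _ _)
  have h1 := hk B hB
  have h2 := hk _ hSB
  rw [← hshift] at h2
  have h3 := measureReal_mono hsub (measure_ne_top μ _)
  have h4 := measureReal_union_le (μ := μ) (Vᶜ ∪ (V \ (Y ∪ S ⁻¹' Y))) ((Y ∩ D) ∪ (S ⁻¹' Y ∩ D))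
  have h5 := measureReal_union_le (μ := μ) Vᶜ (V \ (Y ∪ S ⁻¹' Y))
  have h6 := measureReal_union_le (μ := μ) (Y ∩ D) (S ⁻¹' Y ∩ D)
  linarith

end GoodDisplacement

/-! ### Approximation by unions of levels -/

theorem levelUnion_Ico_eq {X : Type*} [AddAction ℝ X] (E : ℕ → Set X) (s : ℕ → ℝ) (h : ℕ → ℕ)
    (j : ℕ) :
    levelUnion (E j) (s j) (Finset.Ico 0 (h j : ℤ)) = ⋃ i < h j, towerLevel E s j i := by
  ext x
  simp only [mem_levelUnion, Set.mem_iUnion, Finset.mem_Ico, exists_prop]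
  constructor
  · rintro ⟨a, ⟨ha0, ha⟩, hx⟩
    lift a to ℕ using ha0
    exact ⟨a, by exact_mod_cast ha, by simpa [towerLevel, flowLevel] using hx⟩
  · rintro ⟨i, hi, hx⟩
    exact ⟨i, ⟨by positivity, by exact_mod_cast hi⟩, by simpa [towerLevel, flowLevel] using hx⟩

namespace IsRankOneFlowWith

variable {X : Type*} [MeasurableSpace X] {μ : Measure X} [AddAction ℝ X]
  {E : ℕ → Set X} {s : ℕ → ℝ} {h : ℕ → ℕ}

theorem pairwise_aedisjoint_flowLevel (hT : IsRankOneFlowWith μ E s h) (j : ℕ) :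
    Set.Pairwise (Finset.Ico 0 (h j : ℤ) : Set ℤ)
      (fun a b => AEDisjoint μ (flowLevel (E j) (s j) a) (flowLevel (E j) (s j) b)) := by
  intro a ha b hb hab
  simp only [Finset.coe_Ico, Set.mem_Ico] at ha hb
  lift a to ℕ using ha.1
  lift b to ℕ using hb.1
  have := hT.disjoint_levels j a (by exact_mod_cast ha.2) b (by exact_mod_cast hb.2)
    (by exact_mod_cast hab)
  simpa [towerLevel, flowLevel] using this

/-- The towers of a rank one flow fill the space: a set of small measure is approximated without
the complement of the tower, unless this complement is itself small, and finitely many sets of small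
measure almost cover the space because `μ` has no atoms. -/
theorem tendsto_measureReal_compl [TopologicalSpace X] [PolishSpace X] [BorelSpace X]
    [IsProbabilityMeasure μ] [NullSingletonClass μ] (hT : IsRankOneFlowWith μ E s h) :
    Tendsto (fun j => μ.real (levelUnion (E j) (s j) (Finset.Ico 0 (h j : ℤ)))ᶜ) atTop (𝓝 0) := by
  simp only [levelUnion_Ico_eq]
  set R : ℕ → Set X := fun j => (⋃ i < h j, towerLevel E s j i)ᶜ with hR
  refine tendsto_order.2 ⟨fun a ha => Eventually.of_forall fun j =>
    ha.trans_le measureReal_nonneg, fun ε hε => ?_⟩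
  have hε2 : 0 < ε / 2 := half_pos hε
  obtain ⟨K, -, hK, hμK⟩ := (MeasurableSet.univ (α := X)).exists_isCompact_sdiff_lt
    (measure_ne_top μ _) (ENNReal.ofReal_pos.2 hε2).ne'
  have hopen : ∀ x : X, ∃ U, {x} ⊆ U ∧ IsOpen U ∧ μ U < ENNReal.ofReal (ε / 2) := fun x => by
    obtain ⟨U, h1, h2, h3⟩ := Set.exists_isOpen_lt_of_lt (μ := μ) {x} (ENNReal.ofReal (ε / 2))
      (by rw [measure_singleton]; exact ENNReal.ofReal_pos.2 hε2)
    exact ⟨U, h1, h2, h3⟩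
  choose U hxU hUo hUμ using hopen
  obtain ⟨t, -, ht⟩ := hK.elim_nhds_subcover U
    fun x _ => (hUo x).mem_nhds (hxU x rfl)
  set ε' : ℝ := ε / (2 * (t.card + 1)) with hε'
  have hε'0 : 0 < ε' := by positivity
  have hUr : ∀ x, μ.real (U x) < ε / 2 := fun x =>
    (ENNReal.lt_ofReal_iff_toReal_lt (measure_ne_top _ _)).1 (hUμ x)
  have hdich : ∀ x, ∀ᶠ j in atTop, μ.real (R j) < ε ∨ μ.real (R j ∩ U x) < ε' := fun x => by
    obtain ⟨A', hA', hlim⟩ := hT.tendsto_points (U x) (hUo x).measurableSet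
    have hlim' : Tendsto (fun j => μ.real (symmDiff (U x) (A' j))) atTop (𝓝 0) := by
      exact (ENNReal.tendsto_toReal ENNReal.zero_ne_top).comp hlim
    filter_upwards [hlim'.eventually_lt_const (lt_min hε2 hε'0)] with j hj
    obtain ⟨P, hP, hAP⟩ := hA' j
    by_cases hRP : R j ∈ P
    · left
      have hsub : R j ⊆ U x ∪ symmDiff (U x) (A' j) := by
        intro y hy
        have : y ∈ A' j := by rw [hAP]; exact ⟨_, hRP, hy⟩
        by_cases hyU : y ∈ U x
        · exact Or.inl hyU
        · exact Or.inr (Or.inr ⟨this, hyU⟩)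
      calc μ.real (R j) ≤ μ.real (U x ∪ symmDiff (U x) (A' j)) := measureReal_mono hsub
        _ ≤ μ.real (U x) + μ.real (symmDiff (U x) (A' j)) := measureReal_union_le _ _
        _ < ε / 2 + ε / 2 := add_lt_add (hUr x) (hj.trans_le (min_le_left _ _))
        _ = ε := add_halves ε
    · right
      have hsub : R j ∩ U x ⊆ symmDiff (U x) (A' j) := by
        rintro y ⟨hyR, hyU⟩
        refine Or.inl ⟨hyU, fun hyA => ?_⟩
        rw [hAP] at hyA
        obtain ⟨C, hC, hyC⟩ := hyA
        rcases hP hC with ⟨i, hi, rfl⟩ | hC'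
        · exact hyR (Set.mem_iUnion₂.2 ⟨i, hi, hyC⟩)
        · rw [Set.mem_singleton_iff.1 hC'] at hC
          exact hRP hC
      exact (measureReal_mono hsub).trans_lt (hj.trans_le (min_le_right _ _))
  filter_upwards [(eventually_all_finset t).2 fun x _ => hdich x] with j hj
  by_contra hcon
  have hsub : R j ⊆ (⋃ x ∈ t, R j ∩ U x) ∪ (Set.univ \ K) := by
    intro y hy
    by_cases hyK : y ∈ K
    · obtain ⟨x, hx, hyx⟩ := Set.mem_iUnion₂.1 (ht hyK)
      exact Or.inl (Set.mem_iUnion₂.2 ⟨x, hx, hy, hyx⟩)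
    · exact Or.inr ⟨trivial, hyK⟩
  have h1 : μ.real (⋃ x ∈ t, R j ∩ U x) ≤ ε / 2 := by
    calc μ.real (⋃ x ∈ t, R j ∩ U x) ≤ ∑ x ∈ t, μ.real (R j ∩ U x) :=
          measureReal_biUnion_finset_le _ _
      _ ≤ ∑ x ∈ t, ε' := Finset.sum_le_sum fun x hx => ((hj x hx).resolve_left hcon).le
      _ = t.card * ε' := by rw [Finset.sum_const, nsmul_eq_mul]
      _ ≤ (t.card + 1) * ε' := by gcongr; linarith
      _ = ε / 2 := by rw [hε']; field_simp
  have h2 : μ.real (Set.univ \ K) < ε / 2 :=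
    (ENNReal.lt_ofReal_iff_toReal_lt (measure_ne_top _ _)).1 hμK
  have h3 := (measureReal_mono hsub (measure_ne_top μ _)).trans (measureReal_union_le _ _)
  exact hcon (by change μ.real (R j) < ε; linarith)

/-- Every measurable set is approximated by unions of levels. Once the tower fills the space, it
does not matter whether the complement of the tower is used. Measurability is assumed only for the
convergence, so that the choice of the index sets is a function on `Set X`. -/
theorem exists_levelUnion_tendsto [TopologicalSpace X] [PolishSpace X] [BorelSpace X]
    [IsProbabilityMeasure μ] [NullSingletonClass μ] (hT : IsRankOneFlowWith μ E s h) (A : Set X) :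
    ∃ I : ℕ → Finset ℤ, (∀ j, I j ⊆ Finset.Ico 0 (h j : ℤ)) ∧
      (MeasurableSet A →
        Tendsto (fun j => μ.real (symmDiff A (levelUnion (E j) (s j) (I j)))) atTop (𝓝 0)) := by
  classical
  by_cases hA : MeasurableSet A
  swap
  · exact ⟨fun _ => ∅, fun _ => Finset.empty_subset _, fun h' => absurd h' hA⟩
  obtain ⟨A', hA', hlim⟩ := hT.tendsto_points A hA
  choose P hP hAP using hA'
  have hlim' : Tendsto (fun j => μ.real (symmDiff A (A' j))) atTop (𝓝 0) := by
    exact (ENNReal.tendsto_toReal ENNReal.zero_ne_top).comp hlim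
  refine ⟨fun j => {a ∈ Finset.Ico 0 (h j : ℤ) | flowLevel (E j) (s j) a ∈ P j},
    fun j => Finset.filter_subset _ _, fun _ => ?_⟩
  refine squeeze_zero (fun _ => measureReal_nonneg) (fun j => ?_)
    (by simpa using hlim'.add hT.tendsto_measureReal_compl)
  refine (measureReal_symmDiff_le (t := A' j) _).trans ?_
  gcongr
  · exact measure_ne_top _ _
  rintro x (⟨hx, hx'⟩ | ⟨hx, hx'⟩)
  · rw [hAP] at hx
    obtain ⟨C, hC, hxC⟩ := hx
    rcases hP j hC with ⟨i, hi, rfl⟩ | hC'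
    · refine absurd (mem_levelUnion.2 ⟨(i : ℤ), Finset.mem_filter.2 ⟨?_, ?_⟩, ?_⟩) hx'
      · exact Finset.mem_Ico.2 ⟨by positivity, by exact_mod_cast hi⟩
      · simpa [towerLevel, flowLevel] using hC
      · simpa [towerLevel, flowLevel] using hxC
    · rw [levelUnion_Ico_eq]
      rw [Set.mem_singleton_iff] at hC'
      rwa [← hC']
  · obtain ⟨a, ha, hxa⟩ := mem_levelUnion.1 hx
    refine absurd ?_ hx'
    rw [hAP]
    exact ⟨_, (Finset.mem_filter.1 ha).2, hxa⟩

/-! ### Strong approximation of the commuting automorphism -/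

/-- Every late tower yields a multiple of its step which approximates `S` on a given finite family
of measurable sets. -/
theorem eventually_exists_symmDiff_image_vadd_le [TopologicalSpace X] [PolishSpace X]
    [BorelSpace X] [IsProbabilityMeasure μ] [NullSingletonClass μ]
    [MeasurableVAdd₂ ℝ X] [VAddInvariantMeasure ℝ X μ] (hT : IsRankOneFlowWith μ E s h)
    {S : X ≃ᵐ X} (hS : MeasurePreserving S μ μ)
    (hcomm : ∀ t : ℝ, ∀ᵐ x ∂μ, S (t +ᵥ x) = t +ᵥ S x) (τ : Finset (Set X))
    (hτ : ∀ B ∈ τ, MeasurableSet B) {δ : ℝ} (hδ : 0 < δ) :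
    ∀ᶠ j in atTop, ∃ k : ℤ, ∀ B ∈ τ,
      μ.real (symmDiff (S '' B) (((k : ℝ) * s j) +ᵥ B)) ≤ δ := by
  classical
  choose I hI hIlim using hT.exists_levelUnion_tendsto
  -- The error for `B` off the overlap is an error for `S B`, hence the family is enlarged.
  set σ : Finset (Set X) := τ ∪ τ.image (S '' ·) with hσ
  have hσm : ∀ B ∈ σ, MeasurableSet B := by
    intro B hB
    rcases Finset.mem_union.1 hB with hB | hB
    · exact hτ B hB
    · obtain ⟨B', hB', rfl⟩ := Finset.mem_image.1 hB
      exact S.measurableSet_image.2 (hτ B' hB')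
  set ε : ℝ := δ / 8 with hε
  have hε0 : 0 < ε := by positivity
  set η : ℝ := min (δ / 24) (ε * δ / (8 * (σ.card + 1))) with hη
  have hη0 : 0 < η := lt_min (by positivity) (by positivity)
  have hη1 : η ≤ δ / 24 := min_le_left _ _
  have hη2 : 2 * σ.card * η / ε ≤ δ / 4 := by
    have h1 : η ≤ ε * δ / (8 * (σ.card + 1)) := min_le_right _ _
    rw [le_div_iff₀ (by positivity)] at h1
    rw [div_le_iff₀ hε0]
    nlinarith
  have hev : ∀ A, MeasurableSet A → ∀ᶠ j in atTop,
      μ.real (symmDiff A (levelUnion (E j) (s j) (I A j))) ≤ η := fun A hA =>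
    (hIlim A hA).eventually_le_const hη0
  filter_upwards [hT.tendsto_measureReal_compl.eventually_le_const hη0,
    (eventually_all_finset σ).2 fun B hB => hev B (hσm B hB),
    (eventually_all_finset σ).2 fun B hB => hev _ (S.measurableSet_image.2 (hσm B hB))]
    with j hj1 hj2 hj3
  obtain ⟨k, hk⟩ := exists_symmDiff_image_vadd_le (hT.measurableSet_base j) hS hcomm
    (Int.natCast_nonneg (h j)) (hT.pairwise_aedisjoint_flowLevel j) hε0 hj1 σ (fun A => I A j)
    (fun A => hI A j) hj2 hj3
  refine ⟨k, fun B hB => (hk B (Finset.mem_union_left _ hB)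
    (Finset.mem_union_right _ (Finset.mem_image_of_mem _ hB))).trans ?_⟩
  linarith

end IsRankOneFlowWith

/-- Diagonal choice: if `p n` can be solved eventually for each `n`, and `p` is decreasing in `n`,
then one sequence solves each `p n` eventually. -/
theorem exists_forall_eventually_of_forall_eventually_exists {α : Type*} [Nonempty α]
    {p : ℕ → ℕ → α → Prop} (hmono : ∀ n m j k, n ≤ m → p m j k → p n j k)
    (hp : ∀ n, ∀ᶠ j in atTop, ∃ k, p n j k) :
    ∃ k : ℕ → α, ∀ n, ∀ᶠ j in atTop, p n j (k j) := by
  classical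
  have hk : ∀ j, ∃ k, (∃ k', p (Nat.findGreatest (fun n => ∃ k, p n j k) j) j k') →
      p (Nat.findGreatest (fun n => ∃ k, p n j k) j) j k := fun j => by
    by_cases hex : ∃ k', p (Nat.findGreatest (fun n => ∃ k, p n j k) j) j k'
    · exact hex.imp fun k hk _ => hk
    · exact ⟨Classical.arbitrary α, fun h' => absurd h' hex⟩
  choose k hk using hk
  refine ⟨k, fun n => ?_⟩
  filter_upwards [hp n, eventually_ge_atTop n] with j hj hnj
  exact hmono _ _ _ _ (Nat.le_findGreatest hnj hj)
    (hk j (Nat.findGreatest_spec (P := fun n => ∃ k, p n j k) hnj hj))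

namespace IsRankOneFlowWith

variable {X : Type*} [MeasurableSpace X] {μ : Measure X} [AddAction ℝ X]
  {E : ℕ → Set X} {s : ℕ → ℝ} {h : ℕ → ℕ}

/-- The weak closure theorem in its strong form: translations by multiples of the steps converge
to `S` in the measure algebra. -/
theorem exists_tendsto_symmDiff [TopologicalSpace X] [PolishSpace X]
    [BorelSpace X] [IsProbabilityMeasure μ] [NullSingletonClass μ]
    [MeasurableVAdd₂ ℝ X] [VAddInvariantMeasure ℝ X μ] (hT : IsRankOneFlowWith μ E s h)
    {S : X ≃ᵐ X} (hS : MeasurePreserving S μ μ)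
    (hcomm : ∀ t : ℝ, ∀ᵐ x ∂μ, S (t +ᵥ x) = t +ᵥ S x) :
    ∃ k : ℕ → ℤ, ∀ B, MeasurableSet B →
      Tendsto (fun j => μ.real (symmDiff (S '' B) (((k j : ℝ) * s j) +ᵥ B))) atTop (𝓝 0) := by
  classical
  -- The unions of levels form a countable family which is dense in the measure algebra.
  obtain ⟨e, he⟩ := exists_surjective_nat (ℕ × Finset ℤ)
  set B : ℕ → Set X := fun n => levelUnion (E (e n).1) (s (e n).1) (e n).2 with hB
  have hBm : ∀ n, MeasurableSet (B n) := fun n =>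
    Finset.measurableSet_biUnion _ fun a _ => measurableSet_flowLevel (hT.measurableSet_base _) a
  obtain ⟨k, hk⟩ := exists_forall_eventually_of_forall_eventually_exists
    (p := fun n j (k : ℤ) => ∀ i ≤ n,
      μ.real (symmDiff (S '' B i) (((k : ℝ) * s j) +ᵥ B i)) ≤ 1 / ((n : ℝ) + 1))
    (fun n m j k hnm hm i hi => (hm i (hi.trans hnm)).trans
      (one_div_le_one_div_of_le (by positivity) (by gcongr)))
    (fun n => by
      filter_upwards [hT.eventually_exists_symmDiff_image_vadd_le hS hcomm
        ((Finset.range (n + 1)).image B) (fun C hC => by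
          obtain ⟨i, -, rfl⟩ := Finset.mem_image.1 hC
          exact hBm i) (δ := 1 / ((n : ℝ) + 1)) (by positivity)] with j hj
      obtain ⟨k, hk⟩ := hj
      exact ⟨k, fun i hi => hk _ (Finset.mem_image_of_mem _
        (Finset.mem_range.2 (Nat.lt_succ_of_le hi)))⟩)
  refine ⟨k, fun C hC => ?_⟩
  refine tendsto_order.2 ⟨fun a ha => Eventually.of_forall fun j =>
    ha.trans_le measureReal_nonneg, fun ε hε => ?_⟩
  obtain ⟨I, -, hIlim⟩ := hT.exists_levelUnion_tendsto C
  obtain ⟨j₀, hj₀⟩ := ((hIlim hC).eventually_lt_const (show 0 < ε / 4 by positivity)).exists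
  obtain ⟨i, hi⟩ := he (j₀, I j₀)
  have hCi : μ.real (symmDiff C (B i)) < ε / 4 := by
    simp only [hB, hi]
    exact hj₀
  obtain ⟨n, hn⟩ := exists_nat_one_div_lt (show 0 < ε / 4 by positivity)
  have hle : 1 / (((max n i : ℕ) : ℝ) + 1) ≤ 1 / ((n : ℝ) + 1) :=
    one_div_le_one_div_of_le (by positivity) (by gcongr; exact le_max_left _ _)
  filter_upwards [hk (max n i)] with j hj
  have h1 := hj i (le_max_right _ _)
  have h2 := measureReal_symmDiff_le (μ := μ) (s := S '' C) (t := S '' B i)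
    (((k j : ℝ) * s j) +ᵥ C)
  have h3 := measureReal_symmDiff_le (μ := μ) (s := S '' B i) (t := ((k j : ℝ) * s j) +ᵥ B i)
    (((k j : ℝ) * s j) +ᵥ C)
  rw [← Set.image_symmDiff S.injective, hS.measureReal_image_equiv] at h2
  rw [← Set.vadd_set_symmDiff, measureReal_vadd] at h3
  rw [symmDiff_comm] at hCi
  rw [symmDiff_comm C] at h2
  linarith

end IsRankOneFlowWith

/-! ### Convergence of the graph joinings -/

theorem abs_measureReal_inter_sub_le {X : Type*} [MeasurableSpace X] {μ : Measure X}
    [IsFiniteMeasure μ] (A B C : Set X) :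
    |μ.real (A ∩ B) - μ.real (A ∩ C)| ≤ μ.real (symmDiff B C) := by
  have key : ∀ B C : Set X, μ.real (A ∩ B) ≤ μ.real (A ∩ C) + μ.real (symmDiff B C) := by
    intro B C
    refine (measureReal_mono ?_).trans (measureReal_union_le _ _)
    rintro x ⟨hA, hB⟩
    by_cases hC : x ∈ C
    · exact Or.inl ⟨hA, hC⟩
    · exact Or.inr (Or.inl ⟨hB, hC⟩)
  have h1 := key B C
  have h2 := key C B
  rw [symmDiff_comm] at h2
  exact abs_sub_le_iff.2 ⟨by linarith, by linarith⟩

/-- Graph joinings converge weakly as soon as they converge on measurable rectangles. -/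
theorem tendsto_graphJoining {X : Type*} [TopologicalSpace X] [SecondCountableTopology X]
    [MeasurableSpace X] [BorelSpace X] (μ : Measure X) [IsProbabilityMeasure μ]
    {R : ℕ → X ≃ᵐ X} {S : X ≃ᵐ X}
    (hR : ∀ A B : Set X, MeasurableSet A → MeasurableSet B →
      Tendsto (fun j => μ.real (A ∩ R j '' B)) atTop (𝓝 (μ.real (A ∩ S '' B)))) :
    Tendsto (fun j => graphJoining μ (R j)) atTop (𝓝 (graphJoining μ S)) := by
  have hpi : IsPiSystem {t : Set (X × X) | ∃ A B : Set X, MeasurableSet A ∧ MeasurableSet B ∧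
      t = A ×ˢ B} := by
    rintro - ⟨A, B, hA, hB, rfl⟩ - ⟨A', B', hA', hB', rfl⟩ -
    exact ⟨A ∩ A', B ∩ B', hA.inter hA', hB.inter hB', Set.prod_inter_prod⟩
  apply hpi.tendsto_probabilityMeasure_of_tendsto_of_mem
  · rintro - ⟨A, B, hA, hB, rfl⟩
    exact hA.prod hB
  · intro u hu x hx
    obtain ⟨a, b, ha, hb, hxa, hxb, hab⟩ := isOpen_prod_iff.1 hu x.1 x.2 hx
    exact ⟨a ×ˢ b, ⟨a, b, ha.measurableSet, hb.measurableSet, rfl⟩,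
      (ha.prod hb).mem_nhds ⟨hxa, hxb⟩, hab⟩
  · rintro - ⟨A, B, hA, hB, rfl⟩
    have hval : ∀ Q : X ≃ᵐ X, ((graphJoining μ Q (A ×ˢ B) : NNReal) : ℝ) = μ.real (A ∩ Q '' B) :=
      fun Q => by
        rw [measureReal_def, ← graphJoining_prod μ Q hA hB]
        rfl
    rw [← NNReal.tendsto_coe]
    simpa only [hval] using hR A B hA hB

theorem mainTheorem1 {X : Type*} [TopologicalSpace X] [PolishSpace X] [MeasurableSpace X]
    [BorelSpace X] (μ : Measure X) [IsProbabilityMeasure μ] [NullSingletonClass μ]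
    [AddAction ℝ X] [MeasurableVAdd₂ ℝ X] [VAddInvariantMeasure ℝ X μ]
    (E : ℕ → Set X) (s : ℕ → ℝ) (h : ℕ → ℕ) (hT : IsRankOneFlowWith μ E s h)
    (S : X ≃ᵐ X) (hS : MeasurePreserving S μ μ)
    (hcomm : ∀ t : ℝ, ∀ᵐ x ∂μ, S (t +ᵥ x) = t +ᵥ S x) :
    ∃ k : ℕ → ℤ,
      Tendsto (fun j => graphJoining μ (MeasurableEquiv.vadd ((k j : ℝ) * s j))) atTop
        (𝓝 (graphJoining μ S)) ∧
      ∀ A B : Set X, MeasurableSet A → MeasurableSet B →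
        Tendsto (fun j => μ.real (A ∩ (((k j : ℝ) * s j) +ᵥ B))) atTop
          (𝓝 (μ.real (A ∩ S '' B))) := by
  obtain ⟨k, hk⟩ := hT.exists_tendsto_symmDiff hS hcomm
  have hset : ∀ A B : Set X, MeasurableSet A → MeasurableSet B →
      Tendsto (fun j => μ.real (A ∩ (((k j : ℝ) * s j) +ᵥ B))) atTop
        (𝓝 (μ.real (A ∩ S '' B))) := by
    intro A B _ hB
    refine tendsto_iff_dist_tendsto_zero.2 (squeeze_zero (fun _ => dist_nonneg) (fun j => ?_)
      (hk B hB))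
    rw [Real.dist_eq, symmDiff_comm]
    exact abs_measureReal_inter_sub_le _ _ _
  exact ⟨k, tendsto_graphJoining μ fun A B hA hB => hset A B hA hB, hset⟩
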